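/- Let $\mathbb{R}^n$ carry a norm $\|\cdot\|$, let matrices carry the induced operator norm, and write $\mathbb{R}_+=[0,\infty)$. Consider, for a real parameter $\varepsilon\ge 0$, the initial value problem $$\dot x=(A_0(t)+\varepsilon F(t))\,x+h(t,x,\varepsilon),\qquad x(t_0)=x_0, \tag{1}$$ where $A_0,F:\mathbb{R}_+\to\mathbb{R}^{n\times n}$ are continuous and $h:\mathbb{R}_+\times\mathbb{R}^n\times E\to\mathbb{R}^n$ for a parameter set $E\subseteq[0,\infty)$ (for instance $E=(0,\infty)$ or $E=[0,\infty)$). Assume: 1. $F$ is bounded; put $k=\sup_{t\ge0}\|F(t)\|$. 2. $\dot x=A_0(t)x$ is globally uniformly exponentially stable: there are $c,\gamma>0$ such that its state transition matrix (the solution of $\partial_tR_{A_0}(t,s)=A_0(t)R_{A_0}(t,s)$, $R_{A_0}(s,s)=I$) satisfies $\|R_{A_0}(t,s)\|\le c\,e^{-\gamma(t-s)}$ for all $t\ge s\ge0$. 3. $h$ is continuous in $(t,x,\varepsilon)$ and locally Lipschitz in $(x,\varepsilon)$, uniformly in $t$. 4. There are continuous functions $\phi\ge 0$ and $\lambda_\varepsilon\ge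 0$ ($\varepsilon\in E$) on $\mathbb{R}_+$ with $\|h(t,x,\varepsilon)\|\le\phi(t)\|x\|+\lambda_\varepsilon(t)$ for all $t\ge0$, $x\in\mathbb{R}^n$, $\varepsilon\in E$. 5. $\phi\in L^p(\mathbb{R}_+)$ for some $p\in[1,\infty)$. 6. With $\gamma_\varepsilon=\gamma-kc\,\varepsilon$, for each $\varepsilon\in E$ there is $M'>0$ with $\lambda_\varepsilon(t)\le M'e^{-\gamma_\varepsilon t}$ for all $t\ge0$. Then for every $\varepsilon\in E$ with $kc\,\varepsilon<\gamma$ (that is, $\varepsilon<\gamma/(kc)$, read as no restriction if $k=0$) there are constants $L,N\ge0$ and $\delta,\theta\in(0,\gamma_\varepsilon]$, independent of $t_0$ and $x_0$, such that for all $t_0\ge0$ and $x_0\in\mathbb{R}^n$ the problem (1) has exactly one maximal (forward in time) solution $x$, and (i) $x$ is defined on $[t_0,\infty)$; (ii) $\|x(t)\|\le L\|x_0\|e^{-\delta(t-t_0)}+N e^{-\theta t}$ for all $t\ge t_0$. -/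

import Mathlib

open Set Topology MeasureTheory
open scoped NNReal ENNReal

/-- `Φ` is the state transition matrix `t ↦ R_A(t, s)` (for `t ≥ s`) of the linear system
`x' = A(t) x`: the solution on `[s, ∞)` of `Φ' = A(t) Φ`, `Φ(s) = I`.
For continuous `A` it exists and is unique on `[s, ∞)`. -/
def IsTransitionMatrix {V : Type*} [NormedAddCommGroup V] [NormedSpace ℝ V]
    (A : ℝ → V →L[ℝ] V) (s : ℝ) (Φ : ℝ → V →L[ℝ] V) : Prop :=
  Φ s = ContinuousLinearMap.id ℝ V ∧
    ∀ t, s ≤ t → HasDerivWithinAt Φ ((A t).comp (Φ t)) (Ici s) t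

/-- The linear system `x' = A(t) x` is globally uniformly exponentially stable with constants
`c, γ > 0`: `‖R_A(t, s)‖ ≤ c e^{-γ (t - s)}` for all `t ≥ s ≥ 0` (operator norm). -/
def GloballyUniformlyExpStable {V : Type*} [NormedAddCommGroup V] [NormedSpace ℝ V]
    (A : ℝ → V →L[ℝ] V) (c γ : ℝ) : Prop :=
  0 < c ∧ 0 < γ ∧ ∀ s, 0 ≤ s → ∀ Φ : ℝ → V →L[ℝ] V, IsTransitionMatrix A s Φ →
    ∀ t, s ≤ t → ‖Φ t‖ ≤ c * Real.exp (-γ * (t - s))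

/-- `h(t, x, ε)` is locally Lipschitz in `(x, ε) ∈ V × E`, uniformly in `t ≥ 0`. -/
def LocallyLipschitzUniformlyInTime {V : Type*} [NormedAddCommGroup V]
    (E : Set ℝ) (h : ℝ → V → ℝ → V) : Prop :=
  ∀ x₀ : V, ∀ ε₀ ∈ E, ∃ K : ℝ≥0, ∃ U ∈ 𝓝[univ ×ˢ E] (x₀, ε₀),
    ∀ t : ℝ, 0 ≤ t → LipschitzOnWith K (fun q : V × ℝ => h t q.1 q.2) U

/-- `x` solves `x' = f(t, x)`, `x(t₀) = x₀` on the interval `I`, where `t₀` is the left endpoint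
of `I` and belongs to `I` (so `I = [t₀, T]`, `[t₀, T)` or `[t₀, ∞)`). -/
def IsSolutionOn {V : Type*} [NormedAddCommGroup V] [NormedSpace ℝ V]
    (f : ℝ → V → V) (t₀ : ℝ) (x₀ : V) (I : Set ℝ) (x : ℝ → V) : Prop :=
  I.OrdConnected ∧ IsLeast I t₀ ∧ x t₀ = x₀ ∧
    ∀ t ∈ I, HasDerivWithinAt x (f t (x t)) I t

/-- `x`, with domain `I`, is a maximal solution: no solution of the same initial value problem
on a larger interval extends it. -/
def IsMaximalSolution {V : Type*} [NormedAddCommGroup V] [NormedSpace ℝ V]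
    (f : ℝ → V → V) (t₀ : ℝ) (x₀ : V) (I : Set ℝ) (x : ℝ → V) : Prop :=
  IsSolutionOn f t₀ x₀ I x ∧
    ∀ (J : Set ℝ) (y : ℝ → V), IsSolutionOn f t₀ x₀ J y → I ⊆ J → EqOn y x I → J = I

/-!
Local Lipschitz continuity gives uniqueness, and the affine bound on the field keeps a solution
bounded on bounded time intervals, so by continuation the solution is global. For the estimate,
variation of constants treats `ε F(t) x + h(t, x, ε)` as a forcing term of the stable system
`x' = A₀(t) x`, and Grönwall's inequality for `e^{γ t} ‖x(t)‖` yields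
`‖x(t)‖ ≲ exp (-γ (t - s) + c ∫_s^t (ε k + φ)) ‖x(s)‖` plus the contribution of `λ_ε`. Since `φ` is
in `L^p` with `p < ∞`, for every `η > 0` there is `C` with `∫_s^t φ ≤ η (t - s) + C` (split at
`φ ≤ η`), so `φ` costs only an arbitrarily small part of the rate `γ_ε = γ - k c ε`; the rate is
kept strictly below `γ_ε` so that the convolution with `e^{-γ_ε s}` produces no factor `t`.
-/

open Filter

/-- The time-dependent vector field `f` is locally Lipschitz in space, locally uniformly in time
`t ∈ I`: near every point of `I × V` one Lipschitz constant serves all nearby times. -/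
def LocallyLipschitzInSpaceOn {V : Type*} [NormedAddCommGroup V] (f : ℝ → V → V) (I : Set ℝ) :
    Prop :=
  ∀ t ∈ I, ∀ x, ∃ K : ℝ≥0, ∃ U ∈ 𝓝 x, ∀ᶠ s in 𝓝[I] t, LipschitzOnWith K (f s) U

namespace LocallyLipschitzInSpaceOn

variable {V : Type*} [NormedAddCommGroup V] {f g : ℝ → V → V} {I J : Set ℝ}

lemma mono (hf : LocallyLipschitzInSpaceOn f J) (hIJ : I ⊆ J) : LocallyLipschitzInSpaceOn f I :=
  fun t ht x =>
    let ⟨K, U, hU, hK⟩ := hf t (hIJ ht) x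
    ⟨K, U, hU, hK.filter_mono (nhdsWithin_mono t hIJ)⟩

lemma add (hf : LocallyLipschitzInSpaceOn f I) (hg : LocallyLipschitzInSpaceOn g I) :
    LocallyLipschitzInSpaceOn (fun t x => f t x + g t x) I := fun t ht x => by
  obtain ⟨K, U, hU, hK⟩ := hf t ht x
  obtain ⟨L, W, hW, hL⟩ := hg t ht x
  refine ⟨K + L, U ∩ W, inter_mem hU hW, ?_⟩
  filter_upwards [hK, hL] with s hKs hLs
  exact (hKs.mono inter_subset_left).add (hLs.mono inter_subset_right)

lemma of_continuousOn_clm [NormedSpace ℝ V] {A : ℝ → V →L[ℝ] V} (hA : ContinuousOn A I) :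
    LocallyLipschitzInSpaceOn (fun t x => A t x) I := fun t ht x => by
  refine ⟨‖A t‖₊ + 1, univ, univ_mem, ?_⟩
  have hlt : ∀ᶠ s in 𝓝[I] t, ‖A s‖₊ < ‖A t‖₊ + 1 :=
    (hA t ht).nnnorm.eventually_lt_const (lt_add_one _)
  filter_upwards [hlt] with s hs
  exact ((A s).lipschitz.weaken hs.le).lipschitzOnWith

end LocallyLipschitzInSpaceOn

lemma LocallyLipschitzUniformlyInTime.locallyLipschitzInSpaceOn {V : Type*}
    [NormedAddCommGroup V] {E : Set ℝ} {h : ℝ → V → ℝ → V}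
    (hh : LocallyLipschitzUniformlyInTime E h) {ε : ℝ} (hε : ε ∈ E) :
    LocallyLipschitzInSpaceOn (fun t x => h t x ε) (Ici 0) := fun t _ x => by
  obtain ⟨K, U, hU, hK⟩ := hh x ε hε
  have hslice : Tendsto (fun y : V => (y, ε)) (𝓝 x) (𝓝[univ ×ˢ E] (x, ε)) :=
    tendsto_nhdsWithin_iff.2
      ⟨(Continuous.prodMk_left ε).tendsto x, .of_forall fun y => ⟨mem_univ y, hε⟩⟩
  refine ⟨K, _, hslice hU, ?_⟩
  filter_upwards [self_mem_nhdsWithin] with s hs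
  have hcomp :=
    (hK s hs).comp (LipschitzWith.prodMk_right ε).lipschitzOnWith (mapsTo_preimage _ U)
  rwa [mul_one] at hcomp

namespace IsSolutionOn

variable {V : Type*} [NormedAddCommGroup V] [NormedSpace ℝ V] {f : ℝ → V → V} {a b c : ℝ}
  {x₀ : V} {I J : Set ℝ} {x y : ℝ → V}

lemma subset_Ici (hx : IsSolutionOn f a x₀ I x) : I ⊆ Ici a := fun _ ht => hx.2.1.2 ht

lemma Icc_subset (hx : IsSolutionOn f a x₀ I x) {t : ℝ} (ht : t ∈ I) : Icc a t ⊆ I :=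
  hx.1.out hx.2.1.1 ht

lemma eq_initial (hx : IsSolutionOn f a x₀ I x) : x a = x₀ := hx.2.2.1

lemma hasDerivWithinAt (hx : IsSolutionOn f a x₀ I x) {t : ℝ} (ht : t ∈ I) :
    HasDerivWithinAt x (f t (x t)) I t := hx.2.2.2 t ht

lemma continuousOn (hx : IsSolutionOn f a x₀ I x) : ContinuousOn x I :=
  fun _ ht => (hx.hasDerivWithinAt ht).continuousWithinAt

lemma mono (hx : IsSolutionOn f a x₀ I x) (hJ : J.OrdConnected) (ha : a ∈ J) (hJI : J ⊆ I) :
    IsSolutionOn f a x₀ J x :=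
  ⟨hJ, ⟨ha, fun _ ht => hx.subset_Ici (hJI ht)⟩, hx.eq_initial,
    fun _ ht => (hx.hasDerivWithinAt (hJI ht)).mono hJI⟩

lemma restrict_Icc (hx : IsSolutionOn f a x₀ I x) {t : ℝ} (ht : t ∈ I) :
    IsSolutionOn f a x₀ (Icc a t) x :=
  hx.mono ordConnected_Icc (left_mem_Icc.2 (hx.subset_Ici ht)) (hx.Icc_subset ht)

lemma hasDerivWithinAt_Ici (hx : IsSolutionOn f a x₀ (Icc a b) x) {t : ℝ} (ht : t ∈ Ico a b) :
    HasDerivWithinAt x (f t (x t)) (Ici t) t :=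
  ((hx.hasDerivWithinAt (Ico_subset_Icc_self ht)).mono
    (Icc_subset_Icc_left ht.1)).mono_of_mem_nhdsWithin (Icc_mem_nhdsGE ht.2)

lemma eventually_eq_nhdsGT (hlip : LocallyLipschitzInSpaceOn f (Icc a b))
    (hx : IsSolutionOn f a x₀ (Icc a b) x) (hy : IsSolutionOn f a x₀ (Icc a b) y)
    {t : ℝ} (ht : t ∈ Ico a b) (hxy : x t = y t) : ∀ᶠ s in 𝓝[>] t, x s = y s := by
  have htI : t ∈ Icc a b := Ico_subset_Icc_self ht
  obtain ⟨K, U, hU, hK⟩ := hlip t htI (x t)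
  have hxU : ∀ᶠ s in 𝓝[Icc a b] t, x s ∈ U := hx.continuousOn t htI hU
  have hyU : ∀ᶠ s in 𝓝[Icc a b] t, y s ∈ U := hy.continuousOn t htI (hxy ▸ hU)
  have hnhds : Icc a b ∈ 𝓝[≥] t :=
    mem_of_superset (Icc_mem_nhdsGE ht.2) (Icc_subset_Icc_left ht.1)
  have hnear : ∀ᶠ s in 𝓝[≥] t, LipschitzOnWith K (f s) U ∧ x s ∈ U ∧ y s ∈ U ∧ s ∈ Icc a b :=
    (hK.and (hxU.and (hyU.and self_mem_nhdsWithin))).filter_mono (nhdsWithin_le_of_mem hnhds)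
  obtain ⟨u, htu, hu⟩ := mem_nhdsGE_iff_exists_Icc_subset.1 hnear
  have hsub : ∀ s ∈ Ico t u, s ∈ Ico a b := fun s hs =>
    ⟨ht.1.trans hs.1, hs.2.trans_le (hu (right_mem_Icc.2 (le_of_lt htu))).2.2.2.2⟩
  have hIcc : Icc t u ⊆ Icc a b := fun s hs => (hu hs).2.2.2
  have heq : EqOn x y (Icc t u) :=
    ODE_solution_unique_of_mem_Icc_right (s := fun _ => U)
      (fun s hs => (hu (Ico_subset_Icc_self hs)).1)
      (hx.continuousOn.mono hIcc) (fun s hs => hx.hasDerivWithinAt_Ici (hsub s hs))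
      (fun s hs => (hu (Ico_subset_Icc_self hs)).2.1)
      (hy.continuousOn.mono hIcc) (fun s hs => hy.hasDerivWithinAt_Ici (hsub s hs))
      (fun s hs => (hu (Ico_subset_Icc_self hs)).2.2.1) hxy
  exact mem_of_superset (Ioc_mem_nhdsGT htu) fun s hs => heq (Ioc_subset_Icc_self hs)

lemma eqOn_Icc (hlip : LocallyLipschitzInSpaceOn f (Icc a b))
    (hx : IsSolutionOn f a x₀ (Icc a b) x) (hy : IsSolutionOn f a x₀ (Icc a b) y) :
    EqOn x y (Icc a b) := by
  have hclosed : IsClosed ({t | x t = y t} ∩ Icc a b) := by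
    rw [inter_comm]
    exact (hx.continuousOn.prodMk hy.continuousOn).preimage_isClosed_of_isClosed isClosed_Icc
      isClosed_diagonal
  exact hclosed.Icc_subset_of_forall_mem_nhdsWithin (hx.eq_initial.trans hy.eq_initial.symm)
    fun t ht => eventually_eq_nhdsGT hlip hx hy ht.2 ht.1

lemma eqOn (hlip : LocallyLipschitzInSpaceOn f J) (hx : IsSolutionOn f a x₀ I x)
    (hy : IsSolutionOn f a x₀ J y) (hIJ : I ⊆ J) : EqOn x y I := fun _ ht =>
  (hx.restrict_Icc ht).eqOn_Icc (hlip.mono (hy.Icc_subset (hIJ ht))) (hy.restrict_Icc (hIJ ht))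
    (right_mem_Icc.2 (hx.subset_Ici ht))

lemma concat (hx : IsSolutionOn f a x₀ (Icc a b) x) (hy : IsSolutionOn f b (x b) (Icc b c) y) :
    IsSolutionOn f a x₀ (Icc a c) ((Iic b).piecewise x y) := by
  set z : ℝ → V := (Iic b).piecewise x y
  have hab : a ≤ b := hx.2.1.1.2
  have hbc : b ≤ c := hy.2.1.1.2
  have hzx : EqOn z x (Icc a b) := fun t ht => piecewise_eq_of_mem _ _ _ ht.2
  have hzy : EqOn z y (Icc b c) := fun t ht => by
    rcases ht.1.eq_or_lt with rfl | hlt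
    · exact (hzx (right_mem_Icc.2 hab)).trans hy.eq_initial.symm
    · exact piecewise_eq_of_notMem _ _ _ (not_le.2 hlt)
  have hleft : ∀ t, HasDerivWithinAt z (f t (z t)) (Icc a b) t := fun t => by
    by_cases ht : t ∈ Icc a b
    · exact hzx ht ▸ (hx.hasDerivWithinAt ht).congr hzx (hzx ht)
    · exact HasFDerivWithinAt.of_notMem_closure (by rwa [isClosed_Icc.closure_eq])
  have hright : ∀ t, HasDerivWithinAt z (f t (z t)) (Icc b c) t := fun t => by
    by_cases ht : t ∈ Icc b c
    · exact hzy ht ▸ (hy.hasDerivWithinAt ht).congr hzy (hzy ht)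
    · exact HasFDerivWithinAt.of_notMem_closure (by rwa [isClosed_Icc.closure_eq])
  refine ⟨ordConnected_Icc, isLeast_Icc (hab.trans hbc),
    (hzx (left_mem_Icc.2 hab)).trans hx.eq_initial, fun t _ => ?_⟩
  exact Icc_union_Icc_eq_Icc hab hbc ▸ (hleft t).union (hright t)

end IsSolutionOn

section Existence

variable {V : Type*} [NormedAddCommGroup V] [NormedSpace ℝ V] {f : ℝ → V → V} {a b : ℝ}
  {x₀ : V} {I : Set ℝ} {x : ℝ → V}

lemma exists_isSolutionOn_of_forall_Icc (hlip : LocallyLipschitzInSpaceOn f I)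
    (hI : I.OrdConnected) (ha : IsLeast I a)
    (hex : ∀ t ∈ I, ∃ x, IsSolutionOn f a x₀ (Icc a t) x) : ∃ x, IsSolutionOn f a x₀ I x := by
  choose! x hx using hex
  have hagree : ∀ t ∈ I, EqOn (fun s => x s s) (x t) (Icc a t) := fun t ht s hs =>
    have hsI : s ∈ I := hI.out ha.1 ht hs
    (hx s hsI).eqOn (hlip.mono (hI.out ha.1 ht)) (hx t ht) (Icc_subset_Icc_right hs.2)
      (right_mem_Icc.2 hs.1)
  have hderiv : ∀ t ∈ I, ∀ s ∈ Icc a t,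
      HasDerivWithinAt (fun s => x s s) (f s (x s s)) (Icc a t) s := fun t ht s hs => by
    have hst : x s s = x t s := hagree t ht hs
    exact hst ▸ ((hx t ht).hasDerivWithinAt hs).congr (hagree t ht) hst
  refine ⟨fun s => x s s, hI, ha, (hx a ha.1).eq_initial, fun t ht => ?_⟩
  have hat : a ≤ t := ha.2 ht
  by_cases hmax : ∃ u ∈ I, t < u
  · obtain ⟨u, hu, htu⟩ := hmax
    refine (hderiv u hu t ⟨hat, htu.le⟩).mono_of_mem_nhdsWithin ?_
    filter_upwards [self_mem_nhdsWithin, mem_nhdsWithin_of_mem_nhds (Iio_mem_nhds htu)]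
      with s hs hsu
    exact ⟨ha.2 hs, le_of_lt hsu⟩
  · push Not at hmax
    exact (hderiv t ht t ⟨hat, le_rfl⟩).mono fun s hs => ⟨ha.2 hs, hmax s hs⟩

lemma exists_isSolutionOn_Icc_of_locallyLipschitz [CompleteSpace V]
    (hlip : LocallyLipschitzInSpaceOn f (Ici a)) (hcont : ∀ x, ContinuousOn (f · x) (Ici a))
    (x₀ : V) : ∃ b > a, ∃ x, IsSolutionOn f a x₀ (Icc a b) x := by
  obtain ⟨K, U, hU, hK⟩ := hlip a self_mem_Ici x₀
  obtain ⟨r, hr, hrU⟩ := Metric.nhds_basis_closedBall.mem_iff.1 hU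
  lift r to ℝ≥0 using hr.le
  set M : ℝ≥0 := ‖f a x₀‖₊ + 1
  have hM : ∀ᶠ s in 𝓝[≥] a, ‖f s x₀‖₊ < M :=
    (hcont x₀ a self_mem_Ici).nnnorm.eventually_lt_const (lt_add_one _)
  obtain ⟨u, hau, hu⟩ := mem_nhdsGE_iff_exists_Icc_subset.1 (hK.and hM)
  set L : ℝ≥0 := K * r + M
  have hL : 0 < (L : ℝ) := by positivity
  set b : ℝ := min u (a + r / L)
  have hab : a < b := lt_min hau (lt_add_of_pos_right _ (div_pos hr hL))
  have hbu : Icc a b ⊆ Icc a u := Icc_subset_Icc_right (min_le_left _ _)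
  have hPL : IsPicardLindelof f (⟨a, left_mem_Icc.2 hab.le⟩ : Icc a b) x₀ r 0 L K :=
    { lipschitzOnWith := fun t ht => (hu (hbu ht)).1.mono hrU
      continuousOn := fun x _ => (hcont x).mono Icc_subset_Ici_self
      norm_le := fun t ht x hx => by
        have hlipx : ‖f t x - f t x₀‖ ≤ K * ‖x - x₀‖ :=
          (hu (hbu ht)).1.norm_sub_le (hrU hx) (hrU (Metric.mem_closedBall_self r.2))
        have hx₀ : ‖f t x₀‖ ≤ M := (hu (hbu ht)).2.le
        calc ‖f t x‖ ≤ ‖f t x - f t x₀‖ + ‖f t x₀‖ := norm_le_norm_sub_add _ _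
          _ ≤ K * r + M := by
              gcongr
              exact hlipx.trans (by gcongr; exact mem_closedBall_iff_norm.1 hx)
      mul_max_le := by
        have hba : b - a ≤ r / L := by linarith [min_le_right u (a + r / L)]
        rw [sub_self, max_eq_left (sub_nonneg.2 hab.le), NNReal.coe_zero, sub_zero, mul_comm]
        exact (le_div_iff₀ hL).1 hba }
  obtain ⟨x, hx₀, hx⟩ := hPL.exists_eq_forall_mem_Icc_hasDerivWithinAt₀
  exact ⟨b, hab, x, ordConnected_Icc, isLeast_Icc hab.le, hx₀, hx⟩

lemma IsSolutionOn.norm_le_gronwallBound {α β : ℝ}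
    (hx : IsSolutionOn f a x₀ (Icc a b) x)
    (hgrowth : ∀ t ∈ Icc a b, ∀ v, ‖f t v‖ ≤ α * ‖v‖ + β) {t : ℝ} (ht : t ∈ Icc a b) :
    ‖x t‖ ≤ gronwallBound ‖x₀‖ α β (t - a) :=
  norm_le_gronwallBound_of_norm_deriv_right_le hx.continuousOn
    (fun _ hs => hx.hasDerivWithinAt_Ici hs) (by rw [hx.eq_initial])
    (fun s hs => hgrowth s (Ico_subset_Icc_self hs) (x s)) t ht

lemma IsSolutionOn.exists_tendsto_nhdsLT [CompleteSpace V] {M : ℝ} (hab : a < b)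
    (hx : IsSolutionOn f a x₀ (Ico a b) x) (hM : ∀ t ∈ Ico a b, ‖f t (x t)‖ ≤ M) :
    ∃ v, Tendsto x (𝓝[<] b) (𝓝 v) := by
  have hlip : LipschitzOnWith M.toNNReal x (Ico a b) :=
    (convex_Ico a b).lipschitzOnWith_of_nnnorm_hasDerivWithin_le
      (fun _ ht => hx.hasDerivWithinAt ht) fun t ht => NNReal.le_toNNReal_of_coe_le (hM t ht)
  exact CompleteSpace.complete <| (cauchy_nhds.mono nhdsWithin_le_nhds).map_of_le
    hlip.uniformContinuousOn (le_principal_iff.2 (Ico_mem_nhdsLT hab))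

lemma IsSolutionOn.update_right (hab : a < b)
    (hcont : ContinuousOn (Function.uncurry f) (Icc a b ×ˢ univ))
    (hx : IsSolutionOn f a x₀ (Ico a b) x) {v : V} (hv : Tendsto x (𝓝[<] b) (𝓝 v)) :
    IsSolutionOn f a x₀ (Icc a b) (Function.update x b v) := by
  set z : ℝ → V := Function.update x b v
  have hzb : z b = v := Function.update_self b v x
  have hzx : EqOn z x (Ico a b) := fun t ht => Function.update_of_ne ht.2.ne _ _
  have hderiv : ∀ t ∈ Ioo a b, HasDerivAt z (f t (x t)) t := fun t ht =>
    ((hx.hasDerivWithinAt (Ioo_subset_Ico_self ht)).congr hzx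
      (hzx (Ioo_subset_Ico_self ht))).hasDerivAt (Ico_mem_nhds ht.1 ht.2)
  have hzv : Tendsto z (𝓝[<] b) (𝓝 v) :=
    hv.congr' (eventually_of_mem (Ico_mem_nhdsLT hab) fun t ht => (hzx ht).symm)
  have hlim : Tendsto (fun t => f t (x t)) (𝓝[<] b) (𝓝 (f b v)) := by
    have hpair : Tendsto (fun t => (t, x t)) (𝓝[<] b) (𝓝[Icc a b ×ˢ univ] (b, v)) :=
      tendsto_nhdsWithin_iff.2 ⟨(tendsto_id.mono_left nhdsWithin_le_nhds).prodMk_nhds hv,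
        eventually_of_mem (Ico_mem_nhdsLT hab) fun t ht =>
          ⟨Ico_subset_Icc_self ht, mem_univ _⟩⟩
    exact (hcont (b, v) ⟨right_mem_Icc.2 hab.le, mem_univ v⟩).tendsto.comp hpair
  have hderivb : HasDerivWithinAt z (f b v) (Iic b) b := by
    refine hasDerivWithinAt_Iic_of_tendsto_deriv (s := Ioo a b)
      (fun t ht => (hderiv t ht).differentiableAt.differentiableWithinAt) ?_ (Ioo_mem_nhdsLT hab) ?_
    · rw [ContinuousWithinAt, hzb]
      exact hzv.mono_left (nhdsWithin_mono b fun t ht => ht.2)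
    · exact hlim.congr'
        (eventually_of_mem (Ioo_mem_nhdsLT hab) fun t ht => (hderiv t ht).deriv.symm)
  refine ⟨ordConnected_Icc, isLeast_Icc hab.le,
    (hzx (left_mem_Ico.2 hab)).trans hx.eq_initial, fun t ht => ?_⟩
  rcases ht.2.eq_or_lt with rfl | htb
  · exact hzb ▸ hderivb.mono Icc_subset_Iic_self
  · have htI : t ∈ Ico a b := ⟨ht.1, htb⟩
    rw [hzx htI]
    refine ((hx.hasDerivWithinAt htI).congr hzx (hzx htI)).mono_of_mem_nhdsWithin ?_
    filter_upwards [self_mem_nhdsWithin, mem_nhdsWithin_of_mem_nhds (Iio_mem_nhds htb)]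
      with s hs hsb
    exact ⟨hs.1, hsb⟩

lemma forall_ge_of_continuation {P : ℝ → Prop} {a : ℝ} (hbase : P a)
    (hmono : ∀ s t, a ≤ s → s ≤ t → P t → P s) (hlimit : ∀ t > a, (∀ s ∈ Ico a t, P s) → P t)
    (hextend : ∀ t ≥ a, P t → ∃ u > t, P u) {t : ℝ} (ht : a ≤ t) : P t := by
  by_contra hPt
  set S : Set ℝ := {s | a ≤ s ∧ ¬P s}
  have hS : S.Nonempty := ⟨t, ht, hPt⟩
  have hbdd : BddBelow S := ⟨a, fun s hs => hs.1⟩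
  have haS : a ≤ sInf S := le_csInf hS fun s hs => hs.1
  have hbelow : ∀ s ∈ Ico a (sInf S), P s := fun s hs => by
    by_contra hPs
    exact notMem_of_lt_csInf hs.2 hbdd ⟨hs.1, hPs⟩
  have hinf : P (sInf S) := haS.eq_or_lt.elim (fun h => h ▸ hbase) fun h => hlimit _ h hbelow
  obtain ⟨u, hu, hPu⟩ := hextend _ haS hinf
  obtain ⟨s, hs, hsu⟩ := exists_lt_of_csInf_lt hS hu
  exact hs.2 (hmono s u hs.1 hsu.le hPu)

lemma IsSolutionOn.exists_norm_vectorField_le {φ ψ : ℝ → ℝ}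
    (hφ : ContinuousOn φ (Icc a b)) (hψ : ContinuousOn ψ (Icc a b))
    (hgrowth : ∀ t ∈ Icc a b, ∀ v, ‖f t v‖ ≤ φ t * ‖v‖ + ψ t)
    (hx : IsSolutionOn f a x₀ (Ico a b) x) : ∃ M, ∀ t ∈ Ico a b, ‖f t (x t)‖ ≤ M := by
  obtain ⟨α, hα⟩ := isCompact_Icc.exists_bound_of_continuousOn hφ
  obtain ⟨β, hβ⟩ := isCompact_Icc.exists_bound_of_continuousOn hψ
  have hlin : ∀ t ∈ Icc a b, ∀ v, ‖f t v‖ ≤ α * ‖v‖ + β := fun t ht v => by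
    refine (hgrowth t ht v).trans ?_
    gcongr
    · exact (Real.le_norm_self _).trans (hα t ht)
    · exact (Real.le_norm_self _).trans (hβ t ht)
  refine ⟨α * gronwallBound ‖x₀‖ α β (b - a) + β, fun t ht => ?_⟩
  have ht' : t ∈ Icc a b := Ico_subset_Icc_self ht
  have hα₀ : 0 ≤ α := (norm_nonneg _).trans (hα t ht')
  have hβ₀ : 0 ≤ β := (norm_nonneg _).trans (hβ t ht')
  have hxt : ‖x t‖ ≤ gronwallBound ‖x₀‖ α β (t - a) :=
    (hx.restrict_Icc ht).norm_le_gronwallBound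
      (fun s hs => hlin s (Icc_subset_Icc_right ht.2.le hs)) (right_mem_Icc.2 ht.1)
  have hmono := gronwallBound_mono (norm_nonneg x₀) hβ₀ hα₀ (sub_le_sub_right ht.2.le a)
  exact (hlin t ht' _).trans (by gcongr; exact hxt.trans hmono)

lemma exists_isSolutionOn_Ici_of_linear_growth [CompleteSpace V] {φ ψ : ℝ → ℝ}
    (hlip : LocallyLipschitzInSpaceOn f (Ici a))
    (hcont : ContinuousOn (Function.uncurry f) (Ici a ×ˢ univ))
    (hφ : ContinuousOn φ (Ici a)) (hψ : ContinuousOn ψ (Ici a))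
    (hgrowth : ∀ t ∈ Ici a, ∀ v, ‖f t v‖ ≤ φ t * ‖v‖ + ψ t) (x₀ : V) :
    ∃ x, IsSolutionOn f a x₀ (Ici a) x := by
  have hlocal : ∀ t ≥ a, ∀ v, ∃ u > t, ∃ y, IsSolutionOn f t v (Icc t u) y := fun t ht v =>
    have hsub : Ici t ⊆ Ici a := Ici_subset_Ici.2 ht
    exists_isSolutionOn_Icc_of_locallyLipschitz (hlip.mono hsub)
      (fun w => (hcont.uncurry_right w (mem_univ w)).mono hsub) v
  refine exists_isSolutionOn_of_forall_Icc hlip ordConnected_Ici isLeast_Ici fun t ht =>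
    forall_ge_of_continuation (P := fun t => ∃ x, IsSolutionOn f a x₀ (Icc a t) x)
      ?_ (fun s t hs hst ⟨x, hx⟩ => ⟨x, hx.restrict_Icc ⟨hs, hst⟩⟩) (fun t hat hex => ?_)
      (fun t hat ⟨x, hx⟩ => ?_) ht
  · obtain ⟨u, hu, x, hx⟩ := hlocal a le_rfl x₀
    exact ⟨x, hx.restrict_Icc (left_mem_Icc.2 hu.le)⟩
  · obtain ⟨x, hx⟩ := exists_isSolutionOn_of_forall_Icc (hlip.mono Ico_subset_Ici_self)
      ordConnected_Ico (isLeast_Ico hat) hex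
    obtain ⟨M, hM⟩ := hx.exists_norm_vectorField_le (hφ.mono Icc_subset_Ici_self)
      (hψ.mono Icc_subset_Ici_self) (fun s hs => hgrowth s hs.1)
    obtain ⟨v, hv⟩ := hx.exists_tendsto_nhdsLT hat hM
    exact ⟨_, hx.update_right hat (hcont.mono (prod_mono_left Icc_subset_Ici_self)) hv⟩
  · obtain ⟨u, hu, y, hy⟩ := hlocal t hat (x t)
    exact ⟨u, hu, _, hx.concat hy⟩

end Existence

section MaximalSolution

variable {V : Type*} [NormedAddCommGroup V] [NormedSpace ℝ V] {f : ℝ → V → V} {a : ℝ} {x₀ : V}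
  {I : Set ℝ} {x y : ℝ → V}

lemma IsSolutionOn.isMaximalSolution_Ici (hx : IsSolutionOn f a x₀ (Ici a) x) :
    IsMaximalSolution f a x₀ (Ici a) x :=
  ⟨hx, fun _ _ hy hJ _ => hy.subset_Ici.antisymm hJ⟩

lemma IsMaximalSolution.eq_Ici_and_eqOn (hy : IsMaximalSolution f a x₀ I y)
    (hlip : LocallyLipschitzInSpaceOn f (Ici a)) (hx : IsSolutionOn f a x₀ (Ici a) x) :
    I = Ici a ∧ EqOn y x (Ici a) := by
  have hyx : EqOn y x I := hy.1.eqOn hlip hx hy.1.subset_Ici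
  obtain rfl : Ici a = I := hy.2 _ x hx hy.1.subset_Ici hyx.symm
  exact ⟨rfl, hyx⟩

end MaximalSolution

section Linear

variable {V : Type*} [NormedAddCommGroup V] [NormedSpace ℝ V] {a : ℝ}

lemma IsTransitionMatrix.comp_right {A Φ : ℝ → V →L[ℝ] V} {B : V →L[ℝ] V} {s : ℝ}
    (hΦ : IsTransitionMatrix A a Φ) (has : a ≤ s) (hB : (Φ s).comp B = .id ℝ V) :
    IsTransitionMatrix A s (fun t => (Φ t).comp B) := by
  refine ⟨hB, fun t ht => ?_⟩
  have hsub : Ici s ⊆ Ici a := Ici_subset_Ici.2 has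
  exact (((hΦ.2 t (has.trans ht)).mono hsub).clm_comp
    (hasDerivWithinAt_const t (Ici s) B)).congr_deriv (by ext v; simp)

variable [CompleteSpace V]

lemma exists_isSolutionOn_Ici_of_continuousOn_clm {A : ℝ → V →L[ℝ] V}
    (hA : ContinuousOn A (Ici a)) (x₀ : V) :
    ∃ x, IsSolutionOn (fun t x => A t x) a x₀ (Ici a) x :=
  exists_isSolutionOn_Ici_of_linear_growth (.of_continuousOn_clm hA)
    ((hA.comp continuousOn_fst fun _ hq => hq.1).clm_apply continuousOn_snd)
    hA.norm continuousOn_const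
    (fun t _ v => ((A t).le_opNorm v).trans_eq (add_zero _).symm) x₀

lemma exists_isSolutionOn_Ici_of_clm_add {A : ℝ → V →L[ℝ] V} {f : ℝ → V → V} {φ ψ : ℝ → ℝ}
    (hA : ContinuousOn A (Ici a)) (hlip : LocallyLipschitzInSpaceOn f (Ici a))
    (hcont : ContinuousOn (Function.uncurry f) (Ici a ×ˢ univ))
    (hφ : ContinuousOn φ (Ici a)) (hψ : ContinuousOn ψ (Ici a))
    (hgrowth : ∀ t ∈ Ici a, ∀ v, ‖f t v‖ ≤ φ t * ‖v‖ + ψ t) (x₀ : V) :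
    ∃ x, IsSolutionOn (fun t v => A t v + f t v) a x₀ (Ici a) x :=
  exists_isSolutionOn_Ici_of_linear_growth (φ := fun t => ‖A t‖ + φ t)
    ((LocallyLipschitzInSpaceOn.of_continuousOn_clm hA).add hlip)
    (((hA.comp continuousOn_fst fun _ hq => hq.1).clm_apply continuousOn_snd).add hcont)
    (hA.norm.add hφ) hψ (fun t ht v => by
      rw [add_mul, add_assoc]
      exact norm_add_le_of_le ((A t).le_opNorm v) (hgrowth t ht v)) x₀

lemma exists_isTransitionMatrix_rightInverse {A : ℝ → V →L[ℝ] V} (hA : ContinuousOn A (Ici a)) :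
    ∃ Φ Ψ : ℝ → V →L[ℝ] V, IsTransitionMatrix A a Φ ∧
      (∀ t ∈ Ici a, HasDerivWithinAt Ψ (-(Ψ t).comp (A t)) (Ici a) t) ∧
      ∀ t ∈ Ici a, (Φ t).comp (Ψ t) = ContinuousLinearMap.id ℝ V := by
  set postcomp := ContinuousLinearMap.compL ℝ V V V
  have hpost : ContinuousOn (fun t => postcomp (A t)) (Ici a) :=
    postcomp.continuous.comp_continuousOn hA
  have hpre : ContinuousOn (fun t => postcomp.flip (A t)) (Ici a) :=
    postcomp.flip.continuous.comp_continuousOn hA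
  obtain ⟨Φ, hΦ⟩ := exists_isSolutionOn_Ici_of_continuousOn_clm hpost (.id ℝ V)
  obtain ⟨Ψ, hΨ⟩ := exists_isSolutionOn_Ici_of_continuousOn_clm hpre.neg (.id ℝ V)
  have hΦ' : ∀ t ∈ Ici a, HasDerivWithinAt Φ ((A t).comp (Φ t)) (Ici a) t :=
    fun _ ht => hΦ.hasDerivWithinAt ht
  have hΨ' : ∀ t ∈ Ici a, HasDerivWithinAt Ψ (-(Ψ t).comp (A t)) (Ici a) t :=
    fun _ ht => hΨ.hasDerivWithinAt ht
  refine ⟨Φ, Ψ, ⟨hΦ.eq_initial, hΦ'⟩, hΨ', ?_⟩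
  -- `Φ Ψ` and the identity both solve `Z' = A Z - Z A`, so uniqueness identifies them.
  have hmul : IsSolutionOn (fun t Z => (postcomp (A t) - postcomp.flip (A t)) Z) a (.id ℝ V)
      (Ici a) (fun t => (Φ t).comp (Ψ t)) := by
    refine ⟨ordConnected_Ici, isLeast_Ici, ?_, fun t ht => ?_⟩
    · simp only [hΦ.eq_initial, hΨ.eq_initial, ContinuousLinearMap.id_comp]
    · refine ((hΦ' t ht).clm_comp (hΨ' t ht)).congr_deriv ?_
      ext v
      simp [postcomp, sub_eq_add_neg]
  have hid : IsSolutionOn (fun t Z => (postcomp (A t) - postcomp.flip (A t)) Z) a (.id ℝ V)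
      (Ici a) (fun _ => .id ℝ V) := by
    refine ⟨ordConnected_Ici, isLeast_Ici, rfl, fun t _ => ?_⟩
    refine (hasDerivWithinAt_const t _ _).congr_deriv ?_
    ext v
    simp [postcomp]
  exact hmul.eqOn (.of_continuousOn_clm (hpost.sub hpre)) hid subset_rfl

lemma eq_add_integral_of_rightInverse {A Φ Ψ : ℝ → V →L[ℝ] V} {x g : ℝ → V}
    (hΨ : ∀ t ∈ Ici a, HasDerivWithinAt Ψ (-(Ψ t).comp (A t)) (Ici a) t)
    (hg : ContinuousOn g (Ici a))
    (hx : ∀ t ∈ Ici a, HasDerivWithinAt x (A t (x t) + g t) (Ici a) t) {t : ℝ} (ht : a ≤ t)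
    (hΦΨ : (Φ t).comp (Ψ t) = .id ℝ V) :
    x t = (Φ t).comp (Ψ a) (x a) + ∫ s in a..t, (Φ t).comp (Ψ s) (g s) := by
  have hderiv : ∀ s ∈ Ici a, HasDerivWithinAt (fun s => Ψ s (x s)) (Ψ s (g s)) (Ici a) s :=
    fun s hs => ((hΨ s hs).clm_apply (hx s hs)).congr_deriv (by simp)
  have hΨg : IntervalIntegrable (fun s => Ψ s (g s)) volume a t :=
    ((ContinuousOn.clm_apply (fun s hs => (hΨ s hs).continuousWithinAt) hg).mono
      Icc_subset_Ici_self).intervalIntegrable_of_Icc ht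
  have hintegral : ∫ s in a..t, Ψ s (g s) = Ψ t (x t) - Ψ a (x a) :=
    intervalIntegral.integral_eq_sub_of_hasDeriv_right_of_le (f := fun s => Ψ s (x s)) ht
      (fun s hs => (hderiv s hs.1).continuousWithinAt.mono Icc_subset_Ici_self)
      (fun s hs => (hderiv s hs.1.le).mono fun r hr => hs.1.le.trans (le_of_lt hr)) hΨg
  calc x t = Φ t (Ψ t (x t)) := (DFunLike.congr_fun hΦΨ (x t)).symm
    _ = Φ t (Ψ a (x a)) + Φ t (∫ s in a..t, Ψ s (g s)) := by
        rw [hintegral, map_sub, add_sub_cancel]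
    _ = _ := congrArg _ ((Φ t).intervalIntegral_comp_comm hΨg).symm

lemma GloballyUniformlyExpStable.norm_le_of_variation_of_constants {A : ℝ → V →L[ℝ] V} {c γ : ℝ}
    (hstab : GloballyUniformlyExpStable A c γ) (hA : ContinuousOn A (Ici a)) (ha : 0 ≤ a)
    {x g : ℝ → V} (hg : ContinuousOn g (Ici a))
    (hx : ∀ t ∈ Ici a, HasDerivWithinAt x (A t (x t) + g t) (Ici a) t) {t : ℝ} (ht : a ≤ t) :
    ‖x t‖ ≤ c * Real.exp (-γ * (t - a)) * ‖x a‖ +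
      ∫ s in a..t, c * Real.exp (-γ * (t - s)) * ‖g s‖ := by
  obtain ⟨Φ, Ψ, hΦ, hΨ, hΦΨ⟩ := exists_isTransitionMatrix_rightInverse hA
  have hevol : ∀ s ∈ Icc a t, ‖(Φ t).comp (Ψ s)‖ ≤ c * Real.exp (-γ * (t - s)) := fun s hs =>
    hstab.2.2 s (ha.trans hs.1) _ (hΦ.comp_right hs.1 (hΦΨ s hs.1)) t hs.2
  rw [eq_add_integral_of_rightInverse hΨ hg hx ht (hΦΨ t ht)]
  refine (norm_add_le _ _).trans (add_le_add ?_ ?_)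
  · exact ((Φ t).comp (Ψ a)).le_of_opNorm_le (hevol a (left_mem_Icc.2 ht)) _
  · refine intervalIntegral.norm_integral_le_of_norm_le ht (.of_forall fun s hs => ?_) ?_
    · exact ((Φ t).comp (Ψ s)).le_of_opNorm_le (hevol s (Ioc_subset_Icc_self hs)) _
    · exact ContinuousOn.intervalIntegrable_of_Icc ht
        (ContinuousOn.mul (by fun_prop) (hg.norm.mono Icc_subset_Ici_self))

end Linear

section Gronwall

lemma hasDerivAt_integral_of_continuousOn_Icc {g : ℝ → ℝ} {a b t : ℝ}
    (hg : ContinuousOn g (Icc a b)) (ht : t ∈ Ioo a b) :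
    HasDerivAt (fun t => ∫ s in a..t, g s) (g t) t :=
  intervalIntegral.integral_hasDerivAt_right
    ((hg.mono (Icc_subset_Icc_right ht.2.le)).intervalIntegrable_of_Icc ht.1.le)
    ((hg.mono Ioo_subset_Icc_self).stronglyMeasurableAtFilter isOpen_Ioo t ht)
    (hg.continuousAt (Icc_mem_nhds ht.1 ht.2))

lemma continuousOn_integral_of_continuousOn_Icc {g : ℝ → ℝ} {a b : ℝ}
    (hg : ContinuousOn g (Icc a b)) : ContinuousOn (fun t => ∫ s in a..t, g s) (Icc a b) := by
  rcases le_total a b with hab | hba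
  · rw [← uIcc_of_le hab] at hg ⊢
    exact intervalIntegral.continuousOn_primitive_interval (hg.integrableOn_compact isCompact_uIcc)
  · exact (subsingleton_Icc_of_ge hba).continuousOn _

lemma add_integral_mul_exp_neg_le {u b q : ℝ → ℝ} {a T C : ℝ} (haT : a ≤ T)
    (hu : ContinuousOn u (Icc a T)) (hb : ContinuousOn b (Icc a T)) (hq : ContinuousOn q (Icc a T))
    (hb₀ : ∀ t ∈ Icc a T, 0 ≤ b t)
    (hle : ∀ t ∈ Icc a T, u t ≤ C + ∫ s in a..t, (b s * u s + q s)) :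
    (C + ∫ s in a..T, (b s * u s + q s)) * Real.exp (-∫ s in a..T, b s) ≤
      C + ∫ s in a..T, Real.exp (-∫ r in a..s, b r) * q s := by
  set B : ℝ → ℝ := fun t => ∫ s in a..t, b s with hB
  set v : ℝ → ℝ := fun t => C + ∫ s in a..t, (b s * u s + q s) with hv
  set w : ℝ → ℝ := fun t => v t * Real.exp (-B t) - ∫ s in a..t, Real.exp (-B s) * q s with hw
  have hbuq : ContinuousOn (fun s => b s * u s + q s) (Icc a T) := (hb.mul hu).add hq
  have hBq : ContinuousOn (fun s => Real.exp (-B s) * q s) (Icc a T) :=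
    (continuousOn_integral_of_continuousOn_Icc hb).neg.rexp.mul hq
  have hwc : ContinuousOn w (Icc a T) :=
    (((continuousOn_integral_of_continuousOn_Icc hbuq).const_add C).mul
      (continuousOn_integral_of_continuousOn_Icc hb).neg.rexp).sub
      (continuousOn_integral_of_continuousOn_Icc hBq)
  have hderiv : ∀ t ∈ Ioo a T, HasDerivAt w (b t * (u t - v t) * Real.exp (-B t)) t :=
    fun t ht => by
      have hB' : HasDerivAt (fun t => Real.exp (-B t)) (Real.exp (-B t) * -b t) t :=
        (hasDerivAt_integral_of_continuousOn_Icc hb ht).fun_neg.exp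
      have hv' : HasDerivAt v (b t * u t + q t) t :=
        (hasDerivAt_integral_of_continuousOn_Icc hbuq ht).const_add C
      refine ((hv'.fun_mul hB').fun_sub
        (hasDerivAt_integral_of_continuousOn_Icc hBq ht)).congr_deriv ?_
      ring
  have hanti : AntitoneOn w (Icc a T) := by
    refine antitoneOn_of_deriv_nonpos (convex_Icc a T) hwc ?_ ?_ <;> rw [interior_Icc]
    · exact fun t ht => (hderiv t ht).differentiableAt.differentiableWithinAt
    · intro t ht
      have huv : u t - v t ≤ 0 := sub_nonpos.2 (hle t (Ioo_subset_Icc_self ht))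
      rw [(hderiv t ht).deriv]
      exact mul_nonpos_of_nonpos_of_nonneg
        (mul_nonpos_of_nonneg_of_nonpos (hb₀ t (Ioo_subset_Icc_self ht)) huv) (Real.exp_pos _).le
  have hwa : w a = C := by
    simp only [hw, hv, hB, intervalIntegral.integral_same, neg_zero, Real.exp_zero, add_zero,
      mul_one, sub_zero]
  exact sub_le_iff_le_add.1 ((hanti (left_mem_Icc.2 haT) (right_mem_Icc.2 haT) haT).trans_eq hwa)

lemma le_of_le_add_integral_mul {u b q : ℝ → ℝ} {a T C : ℝ} (haT : a ≤ T)
    (hu : ContinuousOn u (Icc a T)) (hb : ContinuousOn b (Icc a T)) (hq : ContinuousOn q (Icc a T))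
    (hb₀ : ∀ t ∈ Icc a T, 0 ≤ b t)
    (hle : ∀ t ∈ Icc a T, u t ≤ C + ∫ s in a..t, (b s * u s + q s)) :
    u T ≤ C * Real.exp (∫ s in a..T, b s) + ∫ s in a..T, Real.exp (∫ r in s..T, b r) * q s := by
  have hintegral : ∫ s in a..T, Real.exp (∫ r in s..T, b r) * q s =
      (∫ s in a..T, Real.exp (-∫ r in a..s, b r) * q s) * Real.exp (∫ s in a..T, b s) := by
    rw [← intervalIntegral.integral_mul_const]
    refine intervalIntegral.integral_congr fun s hs => ?_
    rw [uIcc_of_le haT] at hs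
    have hsplit : ∫ r in s..T, b r = (∫ r in a..T, b r) - ∫ r in a..s, b r :=
      (intervalIntegral.integral_interval_sub_left (hb.intervalIntegrable_of_Icc haT)
        ((hb.mono (Icc_subset_Icc_right hs.2)).intervalIntegrable_of_Icc hs.1)).symm
    simp only [hsplit, sub_eq_neg_add, Real.exp_add]
    ring
  rw [hintegral, ← add_mul, ← div_le_iff₀ (Real.exp_pos _), div_eq_mul_inv, ← Real.exp_neg]
  refine le_trans ?_ (add_integral_mul_exp_neg_le haT hu hb hq hb₀ hle)
  gcongr
  exact hle T (right_mem_Icc.2 haT)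

end Gronwall

section SlowGrowth

lemma le_add_rpow_mul_rpow {η x q : ℝ} (hη : 0 < η) (hx : 0 ≤ x) (hq : 1 ≤ q) :
    x ≤ η + η ^ (1 - q) * x ^ q := by
  rcases le_total x η with hxη | hηx
  · exact hxη.trans (le_add_of_nonneg_right (by positivity))
  · have hpos : 0 < x := hη.trans_le hηx
    have hpow : x ^ (1 - q) ≤ η ^ (1 - q) :=
      Real.rpow_le_rpow_of_nonpos hη hηx (sub_nonpos.2 hq)
    calc x = x ^ (1 - q) * x ^ q := by rw [← Real.rpow_add hpos, sub_add_cancel, Real.rpow_one]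
      _ ≤ η ^ (1 - q) * x ^ q := by gcongr
      _ ≤ η + η ^ (1 - q) * x ^ q := le_add_of_nonneg_left hη.le

lemma exists_setIntegral_norm_le_of_memLp {α F : Type*} [MeasurableSpace α] {μ : Measure α}
    [NormedAddCommGroup F] {f : α → F} {p : ℝ≥0∞} (hp : 1 ≤ p) (hp_top : p ≠ ∞)
    (hf : MemLp f p μ) {η : ℝ} (hη : 0 < η) :
    ∃ C, ∀ s, μ s ≠ ∞ → ∫ x in s, ‖f x‖ ∂μ ≤ η * μ.real s + C := by
  set q : ℝ := p.toReal
  have hq : 1 ≤ q := ENNReal.toReal_one ▸ ENNReal.toReal_mono hp_top hp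
  have hfq : Integrable (fun x => ‖f x‖ ^ q) μ :=
    hf.integrable_norm_rpow (zero_lt_one.trans_le hp).ne' hp_top
  refine ⟨η ^ (1 - q) * ∫ x, ‖f x‖ ^ q ∂μ, fun s hs => ?_⟩
  have hconst : IntegrableOn (fun _ => η) s μ := integrableOn_const hs
  calc ∫ x in s, ‖f x‖ ∂μ ≤ ∫ x in s, (η + η ^ (1 - q) * ‖f x‖ ^ q) ∂μ :=
        integral_mono_of_nonneg (.of_forall fun _ => norm_nonneg _)
          (hconst.add (hfq.integrableOn.const_mul _))
          (.of_forall fun x => le_add_rpow_mul_rpow hη (norm_nonneg _) hq)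
    _ = η * μ.real s + η ^ (1 - q) * ∫ x in s, ‖f x‖ ^ q ∂μ := by
        rw [integral_add hconst (hfq.integrableOn.const_mul _), setIntegral_const, smul_eq_mul,
          integral_const_mul, mul_comm η]
    _ ≤ η * μ.real s + η ^ (1 - q) * ∫ x, ‖f x‖ ^ q ∂μ := by
        refine add_le_add le_rfl (mul_le_mul_of_nonneg_left ?_ (by positivity))
        exact setIntegral_le_integral hfq (ae_of_all _ fun x => Real.rpow_nonneg (norm_nonneg _) _)

lemma exists_integral_norm_le_of_memLp {F : Type*} [NormedAddCommGroup F] {f : ℝ → F} {p : ℝ≥0∞}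
    {a : ℝ} (hp : 1 ≤ p) (hp_top : p ≠ ∞) (hf : MemLp f p (volume.restrict (Ici a))) {η : ℝ}
    (hη : 0 < η) : ∃ C, ∀ s t, a ≤ s → s ≤ t → ∫ r in s..t, ‖f r‖ ≤ η * (t - s) + C := by
  obtain ⟨C, hC⟩ := exists_setIntegral_norm_le_of_memLp hp hp_top hf hη
  refine ⟨C, fun s t has hst => ?_⟩
  have hsub : Ioc s t ⊆ Ici a := fun r hr => has.trans hr.1.le
  have hvol : (volume.restrict (Ici a)) (Ioc s t) = volume (Ioc s t) :=
    Measure.restrict_eq_self _ hsub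
  have hCst := hC (Ioc s t) (hvol ▸ measure_Ioc_lt_top.ne)
  rwa [Measure.restrict_restrict_of_subset hsub, measureReal_def, hvol, ← measureReal_def,
    Real.volume_real_Ioc_of_le hst, ← intervalIntegral.integral_of_le hst] at hCst

end SlowGrowth

section Perturbation

lemma integral_exp_neg_mul_le {κ a : ℝ} (hκ : 0 < κ) (ha : 0 ≤ a) (t : ℝ) :
    ∫ s in a..t, Real.exp (-κ * s) ≤ 1 / κ := by
  rw [intervalIntegral.integral_comp_mul_left _ (neg_ne_zero.2 hκ.ne'), integral_exp, smul_eq_mul,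
    inv_neg, neg_mul, ← mul_neg, neg_sub, inv_mul_eq_div]
  gcongr
  have hexp : Real.exp (-κ * a) ≤ 1 := Real.exp_le_one_iff.2 (by nlinarith)
  linarith [Real.exp_pos (-κ * t)]

lemma integral_mul_exp_neg_le {K : ℝ → ℝ} {D M ν Γ a t : ℝ} (ha : 0 ≤ a) (hat : a ≤ t)
    (hM : 0 ≤ M) (hν : ν < Γ) (hK : ∀ s ∈ Icc a t, ‖K s‖ ≤ D * Real.exp (-ν * (t - s))) :
    ∫ s in a..t, K s * (M * Real.exp (-Γ * s)) ≤ D * M / (Γ - ν) * Real.exp (-ν * t) := by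
  have hD : 0 ≤ D := (norm_nonneg (K t)).trans (by simpa using hK t (right_mem_Icc.2 hat))
  have hintegrand : ∀ s ∈ Icc a t, ‖K s * (M * Real.exp (-Γ * s))‖ ≤
      D * M * Real.exp (-ν * t) * Real.exp (-(Γ - ν) * s) := fun s hs => by
    calc ‖K s * (M * Real.exp (-Γ * s))‖ = ‖K s‖ * (M * Real.exp (-Γ * s)) := by
          rw [norm_mul, Real.norm_of_nonneg (by positivity : 0 ≤ M * Real.exp (-Γ * s))]
      _ ≤ D * Real.exp (-ν * (t - s)) * (M * Real.exp (-Γ * s)) := by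
          gcongr
          exact hK s hs
      _ = D * M * (Real.exp (-ν * (t - s)) * Real.exp (-Γ * s)) := by ring
      _ = D * M * Real.exp (-ν * t) * Real.exp (-(Γ - ν) * s) := by
          rw [mul_assoc (D * M), ← Real.exp_add, ← Real.exp_add]
          ring_nf
  calc ∫ s in a..t, K s * (M * Real.exp (-Γ * s))
      ≤ ∫ s in a..t, D * M * Real.exp (-ν * t) * Real.exp (-(Γ - ν) * s) :=
        (Real.le_norm_self _).trans <| intervalIntegral.norm_integral_le_of_norm_le hat
          (.of_forall fun s hs => hintegrand s (Ioc_subset_Icc_self hs))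
          (Continuous.intervalIntegrable (by fun_prop) _ _)
    _ ≤ D * M * Real.exp (-ν * t) * (1 / (Γ - ν)) := by
        rw [intervalIntegral.integral_const_mul]
        gcongr
        exact integral_exp_neg_mul_le (sub_pos.2 hν) ha t
    _ = D * M / (Γ - ν) * Real.exp (-ν * t) := by ring

variable {V : Type*} [NormedAddCommGroup V] [NormedSpace ℝ V] [CompleteSpace V]
  {A : ℝ → V →L[ℝ] V} {c γ a t : ℝ} {x g : ℝ → V} {b q : ℝ → ℝ}

lemma GloballyUniformlyExpStable.exp_mul_norm_le
    (hstab : GloballyUniformlyExpStable A c γ) (hA : ContinuousOn A (Ici a)) (ha : 0 ≤ a)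
    (hg : ContinuousOn g (Ici a))
    (hx : ∀ t ∈ Ici a, HasDerivWithinAt x (A t (x t) + g t) (Ici a) t) (ht : a ≤ t) :
    Real.exp (γ * t) * ‖x t‖ ≤
      c * Real.exp (γ * a) * ‖x a‖ + ∫ s in a..t, c * Real.exp (γ * s) * ‖g s‖ := by
  have hexp : ∀ s, Real.exp (γ * t) * Real.exp (-γ * (t - s)) = Real.exp (γ * s) := fun s => by
    rw [← Real.exp_add]
    ring_nf
  calc Real.exp (γ * t) * ‖x t‖
      ≤ Real.exp (γ * t) * (c * Real.exp (-γ * (t - a)) * ‖x a‖ +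
          ∫ s in a..t, c * Real.exp (-γ * (t - s)) * ‖g s‖) := by
        gcongr
        exact hstab.norm_le_of_variation_of_constants hA ha hg hx ht
    _ = _ := by
        simp only [mul_add, ← intervalIntegral.integral_const_mul, mul_left_comm _ c, ← mul_assoc]
        simp only [mul_assoc, hexp]

lemma GloballyUniformlyExpStable.norm_le_of_norm_le_mul_add
    (hstab : GloballyUniformlyExpStable A c γ) (hA : ContinuousOn A (Ici a)) (ha : 0 ≤ a)
    (hg : ContinuousOn g (Ici a))
    (hx : ∀ t ∈ Ici a, HasDerivWithinAt x (A t (x t) + g t) (Ici a) t)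
    (hb : ContinuousOn b (Ici a)) (hq : ContinuousOn q (Ici a)) (hb₀ : ∀ t ∈ Ici a, 0 ≤ b t)
    (hbound : ∀ t ∈ Ici a, ‖g t‖ ≤ b t * ‖x t‖ + q t) (ht : a ≤ t) :
    ‖x t‖ ≤ c * Real.exp (-γ * (t - a) + c * ∫ r in a..t, b r) * ‖x a‖ +
      ∫ s in a..t, c * Real.exp (-γ * (t - s) + c * ∫ r in s..t, b r) * q s := by
  have hc : 0 < c := hstab.1
  have hxc : ContinuousOn x (Ici a) := fun s hs => (hx s hs).continuousWithinAt
  have hexp : ContinuousOn (fun s => Real.exp (γ * s)) (Ici a) := by fun_prop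
  have hsub : Icc a t ⊆ Ici a := Icc_subset_Ici_self
  have hgron := le_of_le_add_integral_mul (u := fun s => Real.exp (γ * s) * ‖x s‖)
    (b := fun s => c * b s) (q := fun s => c * Real.exp (γ * s) * q s)
    (C := c * Real.exp (γ * a) * ‖x a‖) ht ((hexp.mul hxc.norm).mono hsub)
    ((hb.const_mul c).mono hsub) (((hexp.const_mul c).mul hq).mono hsub)
    (fun s hs => mul_nonneg hc.le (hb₀ s hs.1)) fun s hs => ?_
  · have hexp' : ∀ s y, Real.exp (-γ * (t - s) + y) =
        Real.exp (-γ * t) * (Real.exp y * Real.exp (γ * s)) := fun s y => by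
      simp only [← Real.exp_add]
      ring_nf
    calc ‖x t‖ = Real.exp (-γ * t) * (Real.exp (γ * t) * ‖x t‖) := by
          rw [← mul_assoc, ← Real.exp_add, neg_mul, neg_add_cancel, Real.exp_zero, one_mul]
      _ ≤ _ := mul_le_mul_of_nonneg_left hgron (Real.exp_pos _).le
      _ = _ := by
          rw [mul_add, ← intervalIntegral.integral_const_mul]
          simp only [hexp', intervalIntegral.integral_const_mul c]
          congr 1
          · ring
          · congr 1
            ext s
            ring
  · refine (hstab.exp_mul_norm_le hA ha hg hx hs.1).trans ?_
    gcongr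
    refine intervalIntegral.integral_mono_on hs.1 ?_ ?_ fun r hr => ?_
    · exact (((hexp.const_mul c).mul hg.norm).mono Icc_subset_Ici_self).intervalIntegrable_of_Icc
        hs.1
    · exact ((((hb.const_mul c).mul (hexp.mul hxc.norm)).add ((hexp.const_mul c).mul hq)).mono
        Icc_subset_Ici_self).intervalIntegrable_of_Icc hs.1
    · calc c * Real.exp (γ * r) * ‖g r‖ ≤ c * Real.exp (γ * r) * (b r * ‖x r‖ + q r) := by
            gcongr
            exact hbound r hr.1
        _ = _ := by ring

lemma GloballyUniformlyExpStable.norm_le_of_integral_le {ν Γ C M : ℝ}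
    (hstab : GloballyUniformlyExpStable A c γ) (hA : ContinuousOn A (Ici a)) (ha : 0 ≤ a)
    (hg : ContinuousOn g (Ici a))
    (hx : ∀ t ∈ Ici a, HasDerivWithinAt x (A t (x t) + g t) (Ici a) t)
    (hb : ContinuousOn b (Ici a)) (hb₀ : ∀ t ∈ Ici a, 0 ≤ b t)
    (hbint : ∀ s t, a ≤ s → s ≤ t → c * ∫ r in s..t, b r ≤ (γ - ν) * (t - s) + C)
    (hM : 0 ≤ M) (hν : ν < Γ) (hbound : ∀ t ∈ Ici a, ‖g t‖ ≤ b t * ‖x t‖ + M * Real.exp (-Γ * t))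
    (ht : a ≤ t) :
    ‖x t‖ ≤ c * Real.exp C * ‖x a‖ * Real.exp (-ν * (t - a)) +
      c * Real.exp C * M / (Γ - ν) * Real.exp (-ν * t) := by
  have hc : 0 < c := hstab.1
  have hevol : ∀ s ∈ Icc a t, c * Real.exp (-γ * (t - s) + c * ∫ r in s..t, b r) ≤
      c * Real.exp C * Real.exp (-ν * (t - s)) := fun s hs => by
    rw [mul_assoc, ← Real.exp_add]
    gcongr ?_ * ?_
    rw [Real.exp_le_exp]
    linarith [hbint s t hs.1 hs.2]
  refine (hstab.norm_le_of_norm_le_mul_add hA ha hg hx hb (by fun_prop) hb₀ hbound ht).trans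
    (add_le_add ?_ (integral_mul_exp_neg_le ha ht hM hν fun s hs => ?_))
  · calc c * Real.exp (-γ * (t - a) + c * ∫ r in a..t, b r) * ‖x a‖
        ≤ c * Real.exp C * Real.exp (-ν * (t - a)) * ‖x a‖ := by
          gcongr ?_ * _
          exact hevol a (left_mem_Icc.2 ht)
      _ = c * Real.exp C * ‖x a‖ * Real.exp (-ν * (t - a)) := by ring
  · rw [Real.norm_of_nonneg (by positivity)]
    exact hevol s hs

lemma exists_mul_integral_add_norm_le {φ : ℝ → ℝ} {p : ℝ≥0∞} {κ ν : ℝ} (hp : 1 ≤ p)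
    (hp_top : p ≠ ∞) (hφ : ContinuousOn φ (Ici a)) (hφp : MemLp φ p (volume.restrict (Ici a)))
    (hc : 0 < c) (hν : ν < γ - c * κ) :
    ∃ C, ∀ s t, a ≤ s → s ≤ t → c * ∫ r in s..t, (κ + ‖φ r‖) ≤ (γ - ν) * (t - s) + C := by
  have hη : 0 < (γ - c * κ - ν) / c := div_pos (sub_pos.2 hν) hc
  obtain ⟨C, hC⟩ := exists_integral_norm_le_of_memLp hp hp_top hφp hη
  refine ⟨c * C, fun s t has hst => ?_⟩
  have hφst : ContinuousOn φ (Icc s t) := hφ.mono fun r hr => has.trans hr.1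
  rw [intervalIntegral.integral_add intervalIntegrable_const
    (hφst.norm.intervalIntegrable_of_Icc hst), intervalIntegral.integral_const, smul_eq_mul]
  calc c * ((t - s) * κ + ∫ r in s..t, ‖φ r‖)
      ≤ c * ((t - s) * κ + ((γ - c * κ - ν) / c * (t - s) + C)) := by
        gcongr
        exact hC s t has hst
    _ = (γ - ν) * (t - s) + c * C := by
        field_simp
        ring

lemma GloballyUniformlyExpStable.exists_norm_le_of_memLp {B : ℝ → V →L[ℝ] V} {f : ℝ → V → V}
    {φ : ℝ → ℝ} {p : ℝ≥0∞} {κ ν Γ M : ℝ} (hstab : GloballyUniformlyExpStable A c γ)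
    (hA : ContinuousOn A (Ici 0)) (hB : ContinuousOn B (Ici 0)) (hBκ : ∀ t ∈ Ici 0, ‖B t‖ ≤ κ)
    (hf : ContinuousOn (Function.uncurry f) (Ici 0 ×ˢ univ)) (hφ : ContinuousOn φ (Ici 0))
    (hp : 1 ≤ p) (hp_top : p ≠ ∞) (hφp : MemLp φ p (volume.restrict (Ici 0)))
    (hM : 0 ≤ M) (hbound : ∀ t ∈ Ici 0, ∀ v, ‖f t v‖ ≤ φ t * ‖v‖ + M * Real.exp (-Γ * t))
    (hνγ : ν < γ - c * κ) (hνΓ : ν < Γ) :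
    ∃ L N : ℝ, 0 ≤ L ∧ 0 ≤ N ∧ ∀ a, 0 ≤ a → ∀ x₀ x,
      IsSolutionOn (fun t v => (A t + B t) v + f t v) a x₀ (Ici a) x → ∀ t, a ≤ t →
        ‖x t‖ ≤ L * ‖x₀‖ * Real.exp (-ν * (t - a)) + N * Real.exp (-ν * t) := by
  have hc : 0 < c := hstab.1
  obtain ⟨C, hC⟩ := exists_mul_integral_add_norm_le hp hp_top hφ hφp hc hνγ
  refine ⟨c * Real.exp C, c * Real.exp C * M / (Γ - ν), by positivity,
    div_nonneg (by positivity) (sub_nonneg.2 hνΓ.le), fun a ha x₀ x hx t ht => ?_⟩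
  have hsub : Ici a ⊆ Ici 0 := Ici_subset_Ici.2 ha
  have hBx : ContinuousOn (fun t => B t (x t) + f t (x t)) (Ici a) :=
    ((hB.mono hsub).clm_apply hx.continuousOn).add
      (hf.comp (continuousOn_id.prodMk hx.continuousOn) fun s hs => ⟨hsub hs, mem_univ _⟩)
  have hderiv : ∀ t ∈ Ici a,
      HasDerivWithinAt x (A t (x t) + (B t (x t) + f t (x t))) (Ici a) t := fun s hs =>
    (hx.hasDerivWithinAt hs).congr_deriv (by rw [add_apply, add_assoc])
  have hnorm : ∀ t ∈ Ici a, ‖B t (x t) + f t (x t)‖ ≤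
      (κ + ‖φ t‖) * ‖x t‖ + M * Real.exp (-Γ * t) := fun s hs => by
    rw [add_mul, add_assoc]
    refine norm_add_le_of_le ((B s).le_of_opNorm_le (hBκ s (hsub hs)) _)
      ((hbound s (hsub hs) _).trans ?_)
    gcongr
    exact Real.le_norm_self _
  rw [← hx.eq_initial]
  exact hstab.norm_le_of_integral_le (hA.mono hsub) ha hBx hderiv
    ((hφ.mono hsub).norm.const_add κ)
    (fun s hs => add_nonneg ((norm_nonneg _).trans (hBκ s (hsub hs))) (norm_nonneg _))
    (fun s t has hst => hC s t (ha.trans has) hst) hM hνΓ hnorm ht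

end Perturbation

theorem theorem2_general {V : Type*} [NormedAddCommGroup V] [NormedSpace ℝ V] [CompleteSpace V]
    (A₀ F : ℝ → V →L[ℝ] V)
    (hA₀ : ContinuousOn A₀ (Ici 0)) (hF : ContinuousOn F (Ici 0))
    (k : ℝ) (hk : IsLUB ((fun t => ‖F t‖) '' Ici 0) k)
    (c γ : ℝ) (hstab : GloballyUniformlyExpStable A₀ c γ)
    (E : Set ℝ) (hE : E ⊆ Ici 0)
    (h : ℝ → V → ℝ → V)
    (hcont : ContinuousOn (fun q : ℝ × V × ℝ => h q.1 q.2.1 q.2.2) (Ici 0 ×ˢ univ ×ˢ E))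
    (hlip : LocallyLipschitzUniformlyInTime E h)
    (φ : ℝ → ℝ) (hφ : ContinuousOn φ (Ici 0))
    (lam : ℝ → ℝ → ℝ)
    (hbound : ∀ ε ∈ E, ∀ t, 0 ≤ t → ∀ x : V, ‖h t x ε‖ ≤ φ t * ‖x‖ + lam ε t)
    (p : ℝ≥0∞) (hp : 1 ≤ p) (hp_top : p ≠ ∞) (hφp : MemLp φ p (volume.restrict (Ici 0)))
    (hdecay : ∀ ε ∈ E, ∃ M' : ℝ, 0 < M' ∧
      ∀ t, 0 ≤ t → lam ε t ≤ M' * Real.exp (-(γ - k * c * ε) * t)) :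
    ∀ ε ∈ E, k * c * ε < γ →
      ∃ L N δ θ : ℝ, 0 ≤ L ∧ 0 ≤ N ∧
        δ ∈ Ioc 0 (γ - k * c * ε) ∧ θ ∈ Ioc 0 (γ - k * c * ε) ∧
        ∀ t₀ : ℝ, 0 ≤ t₀ → ∀ x₀ : V,
          (∃ (I : Set ℝ) (x : ℝ → V),
            IsMaximalSolution (fun t y => (A₀ t + ε • F t) y + h t y ε) t₀ x₀ I x ∧
            ∀ (J : Set ℝ) (y : ℝ → V),
              IsMaximalSolution (fun t y => (A₀ t + ε • F t) y + h t y ε) t₀ x₀ J y →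
                J = I ∧ EqOn y x I) ∧
          ∀ (I : Set ℝ) (x : ℝ → V),
            IsMaximalSolution (fun t y => (A₀ t + ε • F t) y + h t y ε) t₀ x₀ I x →
              I = Ici t₀ ∧
              ∀ t, t₀ ≤ t →
                ‖x t‖ ≤ L * ‖x₀‖ * Real.exp (-δ * (t - t₀)) + N * Real.exp (-θ * t) := by
  intro ε hε hεγ
  obtain ⟨M, hM, hMdecay⟩ := hdecay ε hε
  have hrate : 0 < γ - k * c * ε := sub_pos.2 hεγ
  have hsmall : (γ - k * c * ε) / 2 < γ - c * (ε * k) := by linarith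
  have hεF : ContinuousOn (fun t => ε • F t) (Ici 0) := hF.const_smul ε
  have hεFk : ∀ t ∈ Ici 0, ‖ε • F t‖ ≤ ε * k := fun t ht => by
    rw [norm_smul, Real.norm_of_nonneg (hE hε)]
    exact mul_le_mul_of_nonneg_left (hk.1 ⟨t, ht, rfl⟩) (hE hε)
  have hhcont : ContinuousOn (Function.uncurry fun t x => h t x ε) (Ici 0 ×ˢ univ) :=
    hcont.comp (f := fun q : ℝ × V => (q.1, q.2, ε)) (by fun_prop)
      fun q hq => ⟨hq.1, mem_univ _, hε⟩
  have hhlip : LocallyLipschitzInSpaceOn (fun t x => h t x ε) (Ici 0) :=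
    hlip.locallyLipschitzInSpaceOn hε
  have hgrowth : ∀ t ∈ Ici 0, ∀ x : V,
      ‖h t x ε‖ ≤ φ t * ‖x‖ + M * Real.exp (-(γ - k * c * ε) * t) := fun t ht x =>
    (hbound ε hε t ht x).trans (add_le_add le_rfl (hMdecay t ht))
  obtain ⟨L, N, hL, hN, hest⟩ := hstab.exists_norm_le_of_memLp hA₀ hεF hεFk hhcont hφ hp hp_top hφp
    hM.le hgrowth hsmall (half_lt_self hrate)
  have hmem : (γ - k * c * ε) / 2 ∈ Ioc 0 (γ - k * c * ε) := ⟨half_pos hrate, half_le_self hrate.le⟩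
  refine ⟨L, N, _, _, hL, hN, hmem, hmem, fun t₀ ht₀ x₀ => ?_⟩
  have hsub : Ici t₀ ⊆ Ici 0 := Ici_subset_Ici.2 ht₀
  have hA : ContinuousOn (fun t => A₀ t + ε • F t) (Ici t₀) := (hA₀.add hεF).mono hsub
  obtain ⟨x, hx⟩ := exists_isSolutionOn_Ici_of_clm_add hA (hhlip.mono hsub)
    (hhcont.mono (prod_mono_left hsub)) (hφ.mono hsub) (by fun_prop)
    (fun t ht => hgrowth t (hsub ht)) x₀
  have hlip' := (LocallyLipschitzInSpaceOn.of_continuousOn_clm hA).add (hhlip.mono hsub)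
  refine ⟨⟨_, x, hx.isMaximalSolution_Ici, fun J y hy => hy.eq_Ici_and_eqOn hlip' hx⟩,
    fun I y hy => ?_⟩
  obtain ⟨rfl, -⟩ := hy.eq_Ici_and_eqOn hlip' hx
  exact ⟨rfl, hest t₀ ht₀ x₀ y hy.1⟩

theorem theorem2 {V : Type*} [NormedAddCommGroup V] [NormedSpace ℝ V] [FiniteDimensional ℝ V]
    -- the linear part `A₀ + ε F`
    (A₀ F : ℝ → V →L[ℝ] V)
    (hA₀ : ContinuousOn A₀ (Ici 0)) (hF : ContinuousOn F (Ici 0))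
    (k : ℝ) (hk : IsLUB ((fun t => ‖F t‖) '' Ici 0) k)
    (c γ : ℝ) (hstab : GloballyUniformlyExpStable A₀ c γ)
    -- the set of parameters for which `h` is defined
    (E : Set ℝ) (hE : E ⊆ Ici 0)
    -- the nonlinear part
    (h : ℝ → V → ℝ → V)
    (hcont : ContinuousOn (fun q : ℝ × V × ℝ => h q.1 q.2.1 q.2.2) (Ici 0 ×ˢ univ ×ˢ E))
    (hlip : LocallyLipschitzUniformlyInTime E h)
    (φ : ℝ → ℝ) (hφ : ContinuousOn φ (Ici 0)) (hφ_nonneg : ∀ t, 0 ≤ t → 0 ≤ φ t)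
    (lam : ℝ → ℝ → ℝ) (hlam : ∀ ε ∈ E, ContinuousOn (lam ε) (Ici 0))
    (hlam_nonneg : ∀ ε ∈ E, ∀ t, 0 ≤ t → 0 ≤ lam ε t)
    (hbound : ∀ ε ∈ E, ∀ t, 0 ≤ t → ∀ x : V, ‖h t x ε‖ ≤ φ t * ‖x‖ + lam ε t)
    (p : ℝ≥0∞) (hp : 1 ≤ p) (hp_top : p ≠ ∞) (hφp : MemLp φ p (volume.restrict (Ici 0)))
    (hdecay : ∀ ε ∈ E, ∃ M' : ℝ, 0 < M' ∧
      ∀ t, 0 ≤ t → lam ε t ≤ M' * Real.exp (-(γ - k * c * ε) * t)) :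
    ∀ ε ∈ E, k * c * ε < γ →
      ∃ L N δ θ : ℝ, 0 ≤ L ∧ 0 ≤ N ∧
        δ ∈ Ioc 0 (γ - k * c * ε) ∧ θ ∈ Ioc 0 (γ - k * c * ε) ∧
        ∀ t₀ : ℝ, 0 ≤ t₀ → ∀ x₀ : V,
          -- there is exactly one maximal solution
          (∃ (I : Set ℝ) (x : ℝ → V),
            IsMaximalSolution (fun t y => (A₀ t + ε • F t) y + h t y ε) t₀ x₀ I x ∧
            ∀ (J : Set ℝ) (y : ℝ → V),
              IsMaximalSolution (fun t y => (A₀ t + ε • F t) y + h t y ε) t₀ x₀ J y →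
                J = I ∧ EqOn y x I) ∧
          -- it is global and satisfies the estimate
          ∀ (I : Set ℝ) (x : ℝ → V),
            IsMaximalSolution (fun t y => (A₀ t + ε • F t) y + h t y ε) t₀ x₀ I x →
              I = Ici t₀ ∧
              ∀ t, t₀ ≤ t →
                ‖x t‖ ≤ L * ‖x₀‖ * Real.exp (-δ * (t - t₀)) + N * Real.exp (-θ * t) := by
  have := FiniteDimensional.complete ℝ V
  exact theorem2_general A₀ F hA₀ hF k hk c γ hstab E hE h hcont hlip φ hφ lam hbound p hp hp_top
    hφp hdecay
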